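/- Let $T>0$ and let $p:\mathbb R\to\mathbb R$ be $T$-periodic and Lebesgue integrable on $[0,T]$ with $\frac1T\int_0^T p(s)\,ds=0$. By a solution of $\ddot x+\operatorname{sign}(x)=p(t)$ on an open interval $I$ we mean a differentiable function $x:I\to\mathbb R$ whose derivative $\dot x$ is absolutely continuous on compact subintervals of $I$ and such that, for almost every $t\in I$, $p(t)-\ddot x(t)=1$ if $x(t)>0$, $p(t)-\ddot x(t)=-1$ if $x(t)<0$, and $p(t)-\ddot x(t)\in[-1,1]$ if $x(t)=0$ (Filippov's convention). Then for every $(t_0,x_0,\dot x_0)\in\mathbb R\times\mathbb R^2$ there is a solution $x$ on $\mathbb R$ with $x(t_0)=x_0$ and $\dot x(t_0)=\dot x_0$, and every such solution satisfies \[ \sup_{t\in\mathbb R}\bigl\{|x(t)|+|\dot x(t)|\bigr\}<\infty . \] Moreover, if $I\ni t_0$ is an open interval and $x$ is a solution on $I$ with $x(t_0)=x_0$ and $\dot x(t_0)=\dot x_0$, then $\sup_{t\in I}\{|x(t)|+|\dot x(t)|\}<\infty$. -/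

import Mathlib

/-- The Filippov (set-valued) extension of the sign function: `{1}` for `x > 0`, `{-1}` for
`x < 0`, and the whole segment `[-1, 1]` on the switching set `x = 0`. -/
def filippovSign (x : ℝ) : Set ℝ :=
  if x = 0 then Set.Icc (-1) 1 else {Real.sign x}

/-- `x` is a solution of `ẍ + sign(x) = p(t)` on the open interval `I`, in the sense of
Carathéodory and Filippov: `x` is differentiable on `I`, its velocity is absolutely continuous on
compact subintervals of `I`, and `p(t) - ẍ(t) ∈ Sign(x(t))` for almost every `t ∈ I`. -/
structure IsSolutionOn (p : ℝ → ℝ) (I : Set ℝ) (x : ℝ → ℝ) : Prop where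
  differentiableAt : ∀ t ∈ I, DifferentiableAt ℝ x t
  absolutelyContinuous : ∀ a ∈ I, ∀ b ∈ I, AbsolutelyContinuousOnInterval (deriv x) a b
  equation : ∀ᵐ t, t ∈ I → ∃ s ∈ filippovSign (x t), HasDerivAt (deriv x) (p t - s) t

/-!
Let `P` and `Q` be bounded first and second primitives of `p`, with `Q` periodic; they exist because
`p` has mean zero. Put `u = ẋ - P`. While `x > 0` the equation says `u' = -1`, so `t + u` and
`u² / 2 + (x - Q)` are conserved; while `x < 0` the same holds for `t - u` and `u² / 2 - (x - Q)`.
In particular a trajectory that leaves `x = 0` with `u = k T / 2` and stays in `x > 0` comes back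
after time `k T` with `u = -k T / 2`, because `Q` is periodic, and the opposite happens in `x < 0`.
These `2 k T`-periodic trajectories form an invariant torus, given with `R = k T / 2` by
`u² / 2 + σ (x - Q(t) + Q(t + σ u - R)) = R² / 2` on the side `σ x ≥ 0`, for `σ = 1` and `σ = -1`.

If `R > 2 sup |P|`, then on `x = 0` the inside of the torus is `|u| < R`, seen from either side
(`section_energy_lt_iff`). Hence being inside is locally constant along any trajectory
(`eventually_insideTorus_iff`): away from `x = 0` by conservation (`branchEnergy_eq_of_pos`), at
`x = 0` and `|u| < R` by continuity, and at `x = 0` and `|u| ≥ R` because `ẋ ≠ 0` there, so that the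
trajectory is on one definite side just before and just after. No uniqueness of solutions is needed.
An interval being connected, a solution stays inside any torus of large `k` that contains its
initial point, and the inside is bounded in `(x, ẋ)` (`IsSolutionOn.bddAbove`).

For existence, `y = x - Q` has to satisfy `ÿ = -sign (y + Q)`. Replacing the sign by a steep
Lipschitz function gives trajectories by the Picard–Lindelöf theorem
(`exists_mollified_trajectory`), and these converge pointwise along an ultrafilter. The limit
velocity is 1-Lipschitz, and it is affine with slope `∓1` near every time at which `y + Q ≠ 0`
(`exists_sign_trajectory`); that is all the Filippov convention asks for.
-/

open Set Filter Topology MeasureTheory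
open scoped NNReal

/-! ### Periodic primitives of the forcing term -/

/-- A periodic forcing term of mean zero has a first and a second primitive that are both bounded,
the second one being periodic. The constant of integration of the first is chosen so that it has
mean zero as well. -/
theorem exists_periodic_primitives {p : ℝ → ℝ} {T : ℝ} (hT : 0 < T)
    (hper : Function.Periodic p T) (hint : IntervalIntegrable p volume 0 T)
    (havg : ∫ s in (0 : ℝ)..T, p s = 0) :
    ∃ P Q : ℝ → ℝ, (∀ a b, AbsolutelyContinuousOnInterval P a b) ∧
      (∀ᵐ t, HasDerivAt P (p t) t) ∧ (∀ t, HasDerivAt Q (P t) t) ∧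
      (∃ M, ∀ t, |P t| ≤ M) ∧ (∃ K, ∀ t, |Q t| ≤ K) ∧ Function.Periodic Q T := by
  have hp : ∀ a b, IntervalIntegrable p volume a b := hper.intervalIntegrable₀ hT.ne' hint
  have hloc : LocallyIntegrable p volume := by
    intro t
    refine ⟨Icc (t - 1) (t + 1), Icc_mem_nhds (by linarith) (by linarith), ?_⟩
    rw [← intervalIntegrable_iff_integrableOn_Icc_of_le (by linarith)]
    exact hp _ _
  set c : ℝ := (∫ s in (0 : ℝ)..T, ∫ r in (0 : ℝ)..s, p r) / T with hc
  set P : ℝ → ℝ := fun t => (∫ s in (0 : ℝ)..t, p s) - c with hP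
  have hPac : ∀ a b, AbsolutelyContinuousOnInterval P a b := by
    intro a b
    -- the primitive based at `0` is absolutely continuous on any interval that contains `0`
    have h1 : AbsolutelyContinuousOnInterval (fun t => ∫ s in (0 : ℝ)..t, p s)
        (min 0 (min a b)) (max 0 (max a b)) := by
      apply (hp _ _).absolutelyContinuousOnInterval_intervalIntegral
      rw [uIcc_of_le (by simp)]
      simp
    have h2 : AbsolutelyContinuousOnInterval (fun _ : ℝ => c) a b :=
      (LipschitzWith.const c).lipschitzOnWith.absolutelyContinuousOnInterval
    refine (h1.mono ?_).sub h2
    rw [uIcc_of_le (a := min 0 (min a b)) (by simp), uIcc]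
    exact Icc_subset_Icc (by simp) (by simp)
  have hPcont : Continuous P := by
    rw [hP]
    exact (intervalIntegral.continuous_primitive hp 0).sub continuous_const
  have hPper : Function.Periodic P T := by
    intro t
    simp only [hP]
    rw [← intervalIntegral.integral_add_adjacent_intervals (hp 0 t) (hp t (t + T)),
      hper.intervalIntegral_add_eq t 0, zero_add, havg, add_zero]
  have hPmean : ∫ s in (0 : ℝ)..T, P s = 0 := by
    simp only [hP]
    rw [intervalIntegral.integral_sub
      ((intervalIntegral.continuous_primitive hp 0).intervalIntegrable _ _) (by simp)]
    simp only [intervalIntegral.integral_const, sub_zero, smul_eq_mul, hc]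
    field_simp
    ring
  set Q : ℝ → ℝ := fun t => ∫ s in (0 : ℝ)..t, P s with hQ
  have hQd : ∀ t, HasDerivAt Q (P t) t := fun t =>
    intervalIntegral.integral_hasDerivAt_right (hPcont.intervalIntegrable _ _)
      (hPcont.stronglyMeasurableAtFilter _ _) hPcont.continuousAt
  have hQper : Function.Periodic Q T := by
    intro t
    simp only [hQ]
    rw [← intervalIntegral.integral_add_adjacent_intervals (hPcont.intervalIntegrable 0 t)
      (hPcont.intervalIntegrable t (t + T)),
      hPper.intervalIntegral_add_eq t 0, zero_add, hPmean, add_zero]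
  have bdd : ∀ f : ℝ → ℝ, Function.Periodic f T → Continuous f → ∃ C, ∀ t, |f t| ≤ C := by
    intro f hf hfc
    obtain ⟨C, hC⟩ := (hf.isBounded_of_continuous hT.ne' hfc).exists_norm_le
    exact ⟨C, fun t => hC _ (mem_range_self t)⟩
  refine ⟨P, Q, hPac, ?_, hQd, bdd P hPper hPcont,
    bdd Q hQper (continuous_iff_continuousAt.2 fun t => (hQd t).continuousAt), hQper⟩
  filter_upwards [LocallyIntegrable.ae_hasDerivAt_integral hloc] with t ht
  exact (ht 0).sub_const c

/-! ### The invariant tori -/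

/-- The first integral that cuts out the invariant torus with parameter `R` in the half space
`σ * x > 0`, where `σ = ±1`. In terms of `u = ẋ - P`, both `u² / 2 + σ (x - Q)` and `u + σ t` are
conserved there; `branchEnergy` is the sum of the former and a function of the latter, chosen so
that the torus is the level set `R² / 2`. -/
noncomputable def branchEnergy (P Q : ℝ → ℝ) (R σ : ℝ) (x : ℝ → ℝ) (t : ℝ) : ℝ :=
  (deriv x t - P t) ^ 2 / 2 + σ * (x t - Q t + Q (t + σ * (deriv x t - P t) - R))

/-- At time `t` the trajectory `x` is inside the invariant torus with parameter `R`. Where `x` is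
nonzero this is the condition on the branch of its sign; on the switching set `x = 0` both branches
are required, and for large `R` the two conditions are equivalent there. -/
def InsideTorus (P Q : ℝ → ℝ) (R : ℝ) (x : ℝ → ℝ) (t : ℝ) : Prop :=
  ∀ σ : ℝ, σ = 1 ∨ σ = -1 → 0 ≤ σ * x t → branchEnergy P Q R σ x t < R ^ 2 / 2

theorem eq_of_mem_filippovSign {σ x s : ℝ} (hσ : σ = 1 ∨ σ = -1) (hx : 0 < σ * x)
    (hs : s ∈ filippovSign x) : s = σ := by
  have hx0 : x ≠ 0 := by rintro rfl; simp at hx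
  rw [filippovSign, if_neg hx0, mem_singleton_iff] at hs
  rcases hσ with rfl | rfl
  · rw [hs, Real.sign_of_pos (by linarith)]
  · rw [hs, Real.sign_of_neg (by linarith)]

section
variable {p P Q x : ℝ → ℝ} {I : Set ℝ} {R σ M : ℝ}

/-- `branchEnergy` is conserved as long as `σ * x > 0`. The endpoints themselves may lie on the
switching set, which is what links the two branches. -/
theorem branchEnergy_eq_of_pos
    (hPac : ∀ a b, AbsolutelyContinuousOnInterval P a b) (hPd : ∀ᵐ t, HasDerivAt P (p t) t)
    (hQd : ∀ t, HasDerivAt Q (P t) t) (hI : I.OrdConnected)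
    (hx : IsSolutionOn p I x) {a b : ℝ} (ha : a ∈ I) (hb : b ∈ I) (hσ : σ = 1 ∨ σ = -1)
    (hpos : ∀ t ∈ uIoo a b, 0 < σ * x t) :
    branchEnergy P Q R σ x b = branchEnergy P Q R σ x a := by
  have hsub : uIcc a b ⊆ I := hI.uIcc_subset ha hb
  have hσσ : σ * σ = 1 := by rcases hσ with rfl | rfl <;> norm_num
  have hac : AbsolutelyContinuousOnInterval (fun t => deriv x t - P t + σ * t) a b := by
    refine ((hx.absolutelyContinuous a ha b hb).sub (hPac a b)).add ?_
    exact ContDiffOn.absolutelyContinuousOnInterval (by fun_prop)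
  have hne : ∀ c : ℝ, ∀ᵐ t : ℝ, t ≠ c := fun c => by simp [ae_iff, measure_singleton]
  -- almost everywhere `u' = ẍ - p = -σ`
  obtain ⟨C, hC⟩ := hac.const_of_ae_hasDerivAt_zero (by
    filter_upwards [hx.equation, hPd, hne a, hne b] with t h1 h2 hta htb ht
    obtain ⟨s, hs, hd⟩ := h1 (hsub ht)
    have hs' : s = σ := by
      refine eq_of_mem_filippovSign hσ (hpos t ?_) hs
      simp only [uIoo, uIcc, mem_Ioo, mem_Icc] at ht ⊢
      grind
    convert! (hd.sub h2).add ((hasDerivAt_id t).const_mul σ) using 1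
    rw [hs']; ring)
  have hG : ∀ t ∈ uIcc a b,
      HasDerivAt (fun t => (C - σ * t) ^ 2 / 2 + σ * (x t - Q t)) 0 t := by
    intro t ht
    have h1 := (hx.differentiableAt t (hsub ht)).hasDerivAt
    have h2 := ((((hasDerivAt_id t).const_mul σ).const_sub C).pow 2).div_const 2
    convert! h2.add ((h1.sub (hQd t)).const_mul σ) using 1
    have := hC t ht
    simp only [id]
    push_cast
    linear_combination -σ * this
  have hGconst := (convex_uIcc a b).norm_image_sub_le_of_norm_hasDerivWithin_le
    (C := 0) (fun t ht => (hG t ht).hasDerivWithinAt) (by simp) left_mem_uIcc right_mem_uIcc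
  rw [zero_mul, norm_le_zero_iff, sub_eq_zero] at hGconst
  have hCa := hC a left_mem_uIcc
  have hCb := hC b right_mem_uIcc
  have ea : deriv x a - P a = C - σ * a := by linarith
  have eb : deriv x b - P b = C - σ * b := by linarith
  have sa : a + σ * (C - σ * a) - R = σ * C - R := by linear_combination -a * hσσ
  have sb : b + σ * (C - σ * b) - R = σ * C - R := by linear_combination -b * hσσ
  simp only [branchEnergy, ea, eb, sa, sb]
  linear_combination hGconst

/-- The two branches of the torus meet the switching set `x = 0` in the same two curves `u = ±R`,
and the inside of either branch is `|u| < R` there. This is where `2 * R` has to be a period of `Q`,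
and `R` large against the Lipschitz constant of `Q`. -/
theorem section_energy_lt_iff (hQ : ∀ s t, |Q s - Q t| ≤ M * |s - t|)
    (hper : ∀ t, Q (t - 2 * R) = Q t) (hR : 2 * M < R) (hσ : σ = 1 ∨ σ = -1)
    (t u : ℝ) :
    u ^ 2 / 2 + σ * (0 - Q t + Q (t + σ * u - R)) < R ^ 2 / 2 ↔ |u| < R := by
  -- at `u = ±R` the two sides agree, since `Q` has period `2 * R`
  have key : ∀ e : ℝ, e = 1 ∨ e = -1 →
      |σ * (0 - Q t + Q (t + σ * u - R))| ≤ M * |u - e * R| := by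
    intro e he
    have h1 : Q t = Q (t + σ * (e * R) - R) := by
      rcases hσ with rfl | rfl <;> rcases he with rfl | rfl
      · congr 1; ring
      · rw [← hper t]; congr 1; ring
      · rw [← hper t]; congr 1; ring
      · congr 1; ring
    have hσ1 : |σ| = 1 := by rcases hσ with rfl | rfl <;> norm_num
    have h2 := hQ (t + σ * u - R) (t + σ * (e * R) - R)
    rw [show t + σ * u - R - (t + σ * (e * R) - R) = σ * (u - e * R) by ring, abs_mul, hσ1,
      one_mul] at h2
    rw [abs_mul, hσ1, one_mul, h1, zero_sub, neg_add_eq_sub]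
    exact h2
  obtain ⟨e, he, hu⟩ : ∃ e : ℝ, (e = 1 ∨ e = -1) ∧ u = e * |u| := by
    rcases le_total 0 u with h | h
    · exact ⟨1, Or.inl rfl, by rw [abs_of_nonneg h, one_mul]⟩
    · exact ⟨-1, Or.inr rfl, by rw [abs_of_nonpos h]; ring⟩
  have h3 := key e he
  have h4 : |u - e * R| = |(|u| - R)| := by
    conv_lhs => rw [hu, ← mul_sub, abs_mul]
    rcases he with rfl | rfl <;> norm_num
  rw [h4, abs_le] at h3
  have h5 := sq_abs u
  have h6 := abs_nonneg u
  rw [← h5]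
  constructor
  · intro h
    by_contra hcon
    push Not at hcon
    rw [abs_of_nonneg (by linarith)] at h3
    nlinarith
  · intro h
    rw [abs_of_neg (by linarith)] at h3
    nlinarith

theorem IsSolutionOn.continuousAt_deriv (hI : IsOpen I) (hx : IsSolutionOn p I x) {t : ℝ}
    (ht : t ∈ I) : ContinuousAt (deriv x) t := by
  obtain ⟨δ, hδ, hball⟩ := Metric.isOpen_iff.1 hI t ht
  have ha : t - δ / 2 ∈ I := hball (by simp [abs_of_pos hδ]; linarith)
  have hb : t + δ / 2 ∈ I := hball (by simp [abs_of_pos hδ]; linarith)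
  have := (hx.absolutelyContinuous _ ha _ hb).continuousOn
  rw [uIcc_of_le (by linarith)] at this
  exact this.continuousAt (Icc_mem_nhds (by linarith) (by linarith))

/-- Being inside a large torus is a locally constant property along a trajectory, even though
nothing is known about how the trajectory meets the switching set inside the torus. -/
theorem eventually_insideTorus_iff (hIo : IsOpen I) (hI : I.OrdConnected)
    (hPac : ∀ a b, AbsolutelyContinuousOnInterval P a b) (hPd : ∀ᵐ t, HasDerivAt P (p t) t)
    (hQd : ∀ t, HasDerivAt Q (P t) t) (hPM : ∀ t, |P t| ≤ M)
    (hper : ∀ t, Q (t - 2 * R) = Q t) (hR : 2 * M < R)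
    (hx : IsSolutionOn p I x) {t : ℝ} (ht : t ∈ I) :
    ∀ᶠ s in 𝓝 t, (InsideTorus P Q R x t ↔ InsideTorus P Q R x s) := by
  have hM : 0 ≤ M := (abs_nonneg _).trans (hPM 0)
  have hxc : ContinuousAt x t := (hx.differentiableAt t ht).continuousAt
  obtain ⟨δ₀, hδ₀, hball⟩ := Metric.isOpen_iff.1 hIo t ht
  by_cases hx0 : x t = 0
  · have hQlip : ∀ s t, |Q s - Q t| ≤ M * |s - t| := by
      intro s t
      exact convex_univ.norm_image_sub_le_of_norm_hasDerivWithin_le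
        (fun r _ => (hQd r).hasDerivWithinAt) (fun r _ => hPM r) (mem_univ t) (mem_univ s)
    have hsec : ∀ σ : ℝ, σ = 1 ∨ σ = -1 →
        (branchEnergy P Q R σ x t < R ^ 2 / 2 ↔ |deriv x t - P t| < R) := by
      intro σ hσ
      rw [branchEnergy, hx0]
      exact section_energy_lt_iff hQlip hper hR hσ _ _
    by_cases hu : |deriv x t - P t| < R
    · have hPc : ContinuousAt P t := by
        have := (hPac (t - 1) (t + 1)).continuousOn
        rw [uIcc_of_le (by linarith)] at this
        exact this.continuousAt (Icc_mem_nhds (by linarith) (by linarith))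
      have hQc : Continuous Q := continuous_iff_continuousAt.2 fun r => (hQd r).continuousAt
      have hdc := hx.continuousAt_deriv hIo ht
      have hec : ∀ σ : ℝ, ContinuousAt (branchEnergy P Q R σ x) t := by
        intro σ
        unfold branchEnergy
        fun_prop
      filter_upwards [(hec 1).eventually_lt_const ((hsec 1 (Or.inl rfl)).2 hu),
        (hec (-1)).eventually_lt_const ((hsec (-1) (Or.inr rfl)).2 hu)] with s h1 h2
      refine iff_of_true (fun σ hσ _ => (hsec σ hσ).2 hu) ?_
      rintro σ (rfl | rfl) _
      exacts [h1, h2]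
    · -- the trajectory crosses `x = 0` transversally, so it stays outside on both sides
      have hout : ¬ InsideTorus P Q R x t := fun h =>
        hu ((hsec 1 (Or.inl rfl)).1 (h 1 (Or.inl rfl) (by simp [hx0])))
      have hw : deriv x t ≠ 0 := by
        intro h0
        rw [h0, zero_sub, abs_neg] at hu
        linarith [hPM t]
      have hslope := hasDerivAt_iff_tendsto_slope.1 (hx.differentiableAt t ht).hasDerivAt
      have hsl : ∀ᶠ s in 𝓝[≠] t, 0 < deriv x t * slope x t s :=
        (hslope.const_mul (deriv x t)).eventually_const_lt (mul_self_pos.2 hw)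
      rw [eventually_nhdsWithin_iff, Metric.eventually_nhds_iff_ball] at hsl
      obtain ⟨δ, hδ, hsl⟩ := hsl
      filter_upwards [Metric.ball_mem_nhds t (lt_min hδ hδ₀)] with s hs
      refine iff_of_false hout ?_
      rw [Metric.mem_ball, lt_min_iff] at hs
      rcases eq_or_ne s t with rfl | hst
      · exact hout
      obtain ⟨σ, hσ, hσw⟩ : ∃ σ : ℝ, (σ = 1 ∨ σ = -1) ∧ 0 < σ * ((s - t) * deriv x t) := by
        rcases lt_or_gt_of_ne (mul_ne_zero (sub_ne_zero.2 hst) hw) with h | h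
        · exact ⟨-1, Or.inr rfl, by linarith⟩
        · exact ⟨1, Or.inl rfl, by linarith⟩
      have hpos : ∀ r ∈ Metric.ball t δ, 0 < (r - t) * (s - t) → 0 < σ * x r := by
        intro r hr hrs
        have hrt : r ≠ t := by rintro rfl; simp at hrs
        have h1 := hsl r hr hrt
        have h2 : x r = slope x t r * (r - t) := by
          rw [slope_def_field, hx0, sub_zero, div_mul_cancel₀ _ (sub_ne_zero.2 hrt)]
        have h3 : 0 < (σ * x r) * ((s - t) * deriv x t) ^ 2 := by
          rw [h2]
          have := mul_pos (mul_pos h1 hrs) hσw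
          nlinarith
        exact pos_of_mul_pos_left h3 (by positivity)
      have hsI : s ∈ I := hball hs.2
      have hEq := branchEnergy_eq_of_pos (R := R) hPac hPd hQd hI hx ht hsI hσ (by
        intro r hr
        have hs1 := hs.1
        rw [Real.dist_eq, abs_lt] at hs1
        simp only [uIoo, mem_Ioo] at hr
        apply hpos r
        · rw [Metric.mem_ball, Real.dist_eq, abs_lt]
          grind
        · rcases le_total t s with h | h
          · rw [min_eq_left h, max_eq_right h] at hr
            exact mul_pos (by linarith) (by linarith)
          · rw [min_eq_right h, max_eq_left h] at hr
            exact mul_pos_of_neg_of_neg (by linarith) (by linarith))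
      intro hin
      have h1 := hin σ hσ (hpos s hs.1 (mul_self_pos.2 (sub_ne_zero.2 hst))).le
      rw [hEq] at h1
      exact hu ((hsec σ hσ).1 h1)
  · obtain ⟨σ, hσ, hσx⟩ : ∃ σ : ℝ, (σ = 1 ∨ σ = -1) ∧ 0 < σ * x t := by
      rcases lt_or_gt_of_ne hx0 with h | h
      · exact ⟨-1, Or.inr rfl, by linarith⟩
      · exact ⟨1, Or.inl rfl, by linarith⟩
    have hinside : ∀ s, 0 < σ * x s →
        (InsideTorus P Q R x s ↔ branchEnergy P Q R σ x s < R ^ 2 / 2) := by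
      refine fun s hs => ⟨fun h => h σ hσ hs.le, fun h τ hτ hτx => ?_⟩
      have : τ = σ := by
        rcases hσ with rfl | rfl <;> rcases hτ with rfl | rfl <;> first | rfl | linarith
      rwa [this]
    obtain ⟨δ, hδ, hpos⟩ := Metric.eventually_nhds_iff_ball.1
      ((hxc.const_mul σ).eventually_const_lt hσx)
    filter_upwards [Metric.ball_mem_nhds t (lt_min hδ hδ₀)] with s hs
    rw [Metric.mem_ball, lt_min_iff] at hs
    rw [hinside t hσx, hinside s (hpos s hs.1),
      branchEnergy_eq_of_pos hPac hPd hQd hI hx ht (hball hs.2) hσ]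
    intro r hr
    refine hpos r ?_
    exact ((convex_ball t δ).ordConnected.uIcc_subset (Metric.mem_ball_self hδ) hs.1)
      (Ioo_subset_Icc_self hr)

/-- Every solution on an open interval is bounded together with its velocity: it stays inside any
large torus that surrounds one of its points. -/
theorem IsSolutionOn.bddAbove {T : ℝ} (hT : 0 < T)
    (hper : Function.Periodic p T) (hint : IntervalIntegrable p volume 0 T)
    (havg : ∫ s in (0 : ℝ)..T, p s = 0) (hIo : IsOpen I) (hI : I.OrdConnected)
    (hx : IsSolutionOn p I x) {t₀ : ℝ} (ht₀ : t₀ ∈ I) :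
    BddAbove ((fun t : ℝ => |x t| + |deriv x t|) '' I) := by
  obtain ⟨P, Q, hPac, hPd, hQd, ⟨M, hM⟩, ⟨K, hK⟩, hQper⟩ :=
    exists_periodic_primitives hT hper hint havg
  have hM0 : 0 ≤ M := (abs_nonneg _).trans (hM 0)
  have hK0 : 0 ≤ K := (abs_nonneg _).trans (hK 0)
  set u₀ := deriv x t₀ - P t₀ with hu₀
  -- a multiple of half the period, so large that the initial point is inside the torus
  obtain ⟨k, hk⟩ := exists_nat_gt ((2 * M + 1 + u₀ ^ 2 + 2 * |x t₀| + 4 * K) / (T / 2))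
  rw [div_lt_iff₀ (by positivity)] at hk
  set R : ℝ := k * (T / 2) with hR
  have hx0 := abs_nonneg (x t₀)
  have hperR : ∀ t, Q (t - 2 * R) = Q t := by
    intro t
    rw [show 2 * R = k * T by rw [hR]; ring]
    exact hQper.sub_nat_mul_eq k
  have hin₀ : InsideTorus P Q R x t₀ := by
    intro σ hσ _
    rw [branchEnergy, ← hu₀]
    have h1 := abs_le.1 (hK t₀)
    have h2 := abs_le.1 (hK (t₀ + σ * u₀ - R))
    have h3 := abs_le.1 (le_refl |x t₀|)
    have h4 : σ * (x t₀ - Q t₀ + Q (t₀ + σ * u₀ - R)) ≤ |x t₀| + 2 * K := by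
      rcases hσ with rfl | rfl <;> linarith
    have h5 : R ≤ R ^ 2 := by nlinarith [sq_nonneg u₀]
    linarith
  have hin : ∀ t ∈ I, InsideTorus P Q R x t := by
    intro t ht
    refine (hI.isPreconnected.induction₂
      (fun s t => InsideTorus P Q R x s ↔ InsideTorus P Q R x t) (fun s hs => ?_)
      (fun _ _ _ _ _ _ => Iff.trans) (fun _ _ _ _ => Iff.symm) ht₀ ht).1 hin₀
    exact (eventually_insideTorus_iff hIo hI hPac hPd hQd hM hperR
      (by nlinarith [sq_nonneg u₀]) hx hs).filter_mono nhdsWithin_le_nhds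
  refine ⟨R ^ 2 / 2 + 2 * K + (R ^ 2 / 2 + 2 * K + 1) + M, ?_⟩
  rintro _ ⟨t, ht, rfl⟩
  obtain ⟨σ, hσ, hσx⟩ : ∃ σ : ℝ, (σ = 1 ∨ σ = -1) ∧ σ * x t = |x t| := by
    rcases le_total 0 (x t) with h | h
    · exact ⟨1, Or.inl rfl, by rw [abs_of_nonneg h, one_mul]⟩
    · exact ⟨-1, Or.inr rfl, by rw [abs_of_nonpos h]; ring⟩
  have h0 := hin t ht σ hσ (hσx ▸ abs_nonneg _)
  rw [branchEnergy] at h0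
  set u := deriv x t - P t with hu
  have h1 := abs_le.1 (hK t)
  have h2 := abs_le.1 (hK (t + σ * u - R))
  have h4 : |x t| - 2 * K ≤ σ * (x t - Q t + Q (t + σ * u - R)) := by
    rw [mul_add, mul_sub, hσx]
    rcases hσ with rfl | rfl <;> linarith
  have h5 : |deriv x t| ≤ |u| + M := by
    rw [show deriv x t = u + P t by rw [hu]; ring]
    exact (abs_add_le _ _).trans (by linarith [hM t])
  have h6 := sq_abs u
  have h7 := abs_nonneg (x t)
  simp only
  nlinarith [sq_nonneg (|u| - 1)]
end

/-! ### Existence of global solutions -/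

/-- A solution of `ÿ = -clamp (n (y + q(t)))` on `[t₀ - n, t₀ + n]`, where `clamp` truncates to
`[-1, 1]`. Outside this interval the values of `y` and `u` carry no information. -/
theorem exists_mollified_trajectory {q : ℝ → ℝ} (hq : Continuous q) (t₀ y₀ u₀ : ℝ) (n : ℕ) :
    ∃ y u : ℝ → ℝ, y t₀ = y₀ ∧ u t₀ = u₀ ∧
      (∀ t ∈ Icc (t₀ - n) (t₀ + n), HasDerivWithinAt y (u t) (Icc (t₀ - n) (t₀ + n)) t) ∧
      (∀ t ∈ Icc (t₀ - n) (t₀ + n),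
        HasDerivWithinAt u (-max (-1) (min 1 (n * (y t + q t)))) (Icc (t₀ - n) (t₀ + n)) t) := by
  have hn : (0 : ℝ) ≤ n := n.cast_nonneg
  set B : ℝ := |u₀| + n with hB
  have hB0 : 0 ≤ B := by positivity
  -- truncating the velocity makes the field bounded, so that its solutions exist on all of
  -- `[t₀ - n, t₀ + n]`; the truncation turns out to be inactive
  let f : ℝ → ℝ × ℝ → ℝ × ℝ := fun t z =>
    (max (-B) (min B z.2), -max (-1) (min 1 (n * (z.1 + q t))))
  have clamp_abs : ∀ c : ℝ, 0 ≤ c → ∀ r : ℝ, |max (-c) (min c r)| ≤ c := fun c hc r =>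
    abs_le.2 ⟨le_max_left _ _, max_le (by linarith) (min_le_left _ _)⟩
  have clamp_lip : ∀ c r s : ℝ, |max (-c) (min c r) - max (-c) (min c s)| ≤ |r - s| := by
    intro c r s
    have h1 := abs_max_sub_max_le_abs (min c r) (min c s) (-c)
    have h2 := abs_min_sub_min_le_max c r c s
    rw [max_comm (-c), max_comm (-c)]
    refine h1.trans (h2.trans ?_)
    simp
  obtain ⟨L, hL⟩ : ∃ L : ℝ≥0, (L : ℝ) = B + 1 := ⟨⟨B + 1, by linarith⟩, rfl⟩
  have hf : IsPicardLindelof f (tmin := t₀ - n) (tmax := t₀ + n) ⟨t₀, by simp [hn]⟩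
      ((y₀, u₀) : ℝ × ℝ) (L * (n : ℝ≥0)) 0 L ((n : ℝ≥0) + 1) := by
    refine ⟨fun t _ => ?_, fun z _ => ?_, fun t _ z _ => ?_, ?_⟩
    · refine LipschitzWith.lipschitzOnWith (LipschitzWith.of_dist_le_mul fun z w => ?_)
      have hz1 : |z.1 - w.1| ≤ dist z w := le_max_left _ _
      have hz2 : |z.2 - w.2| ≤ dist z w := le_max_right _ _
      have hd : 0 ≤ dist z w := dist_nonneg
      push_cast
      rw [Prod.dist_eq]
      refine max_le ?_ ?_
      · exact (clamp_lip _ _ _).trans (hz2.trans (by nlinarith))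
      · rw [dist_neg_neg]
        refine (clamp_lip _ _ _).trans ?_
        rw [← mul_sub, abs_mul, abs_of_nonneg hn, add_sub_add_right_eq_sub]
        nlinarith
    · exact Continuous.continuousOn (by fun_prop)
    · rw [Prod.norm_def]
      refine max_le ?_ ?_
      · exact (clamp_abs B hB0 _).trans (by linarith)
      · rw [norm_neg]
        exact (clamp_abs 1 zero_le_one _).trans (by linarith)
    · simp
  obtain ⟨α, hα0, hα⟩ := hf.exists_eq_forall_mem_Icc_hasDerivWithinAt₀
  have hd1 : ∀ t ∈ Icc (t₀ - n) (t₀ + n), HasDerivWithinAt (fun t => (α t).1)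
      (max (-B) (min B (α t).2)) (Icc (t₀ - n) (t₀ + n)) t := fun t ht =>
    (hasFDerivAt_fst.comp_hasDerivWithinAt t (hα t ht) :)
  have hd2 : ∀ t ∈ Icc (t₀ - n) (t₀ + n), HasDerivWithinAt (fun t => (α t).2)
      (-max (-1) (min 1 (n * ((α t).1 + q t)))) (Icc (t₀ - n) (t₀ + n)) t := fun t ht =>
    (hasFDerivAt_snd.comp_hasDerivWithinAt t (hα t ht) :)
  refine ⟨fun t => (α t).1, fun t => (α t).2, by simp [hα0], by simp [hα0], fun t ht => ?_, hd2⟩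
  have h1 : |(α t).2 - (α t₀).2| ≤ 1 * |t - t₀| :=
    (convex_Icc _ _).norm_image_sub_le_of_norm_hasDerivWithin_le hd2
      (fun s _ => by rw [norm_neg]; exact clamp_abs 1 zero_le_one _) (by simp [hn]) ht
  have h2 : |t - t₀| ≤ n := abs_le.2 ⟨by linarith [ht.1], by linarith [ht.2]⟩
  have h3 : |(α t).2| ≤ B := by
    have h4 := abs_sub_abs_le_abs_sub (α t).2 (α t₀).2
    have h5 : (α t₀).2 = u₀ := by rw [hα0]
    rw [h5] at h1 h4
    linarith
  have h6 := hd1 t ht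
  rwa [min_eq_right (abs_le.1 h3).2, max_eq_right (abs_le.1 h3).1] at h6

/-- A global solution of `ÿ = -sign (y + q(t))` for continuous `q`, with velocity `u`. On the set
`y + q = 0` the Filippov convention only asks for `|u'| ≤ 1`, which the Lipschitz bound on `u`
provides; so a pointwise limit of mollified trajectories suffices. -/
theorem exists_sign_trajectory {q : ℝ → ℝ} (hq : Continuous q) (t₀ y₀ u₀ : ℝ) :
    ∃ y u : ℝ → ℝ, y t₀ = y₀ ∧ u t₀ = u₀ ∧ (∀ t, HasDerivAt y (u t) t) ∧ LipschitzWith 1 u ∧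
      ∀ σ : ℝ, σ = 1 ∨ σ = -1 → ∀ t, 0 < σ * (y t + q t) → HasDerivAt u (-σ) t := by
  choose Y U hY0 hU0 hYd hUd using exists_mollified_trajectory hq t₀ y₀ u₀
  have hUlip : ∀ n : ℕ, ∀ s ∈ Icc (t₀ - n) (t₀ + n), ∀ t ∈ Icc (t₀ - n) (t₀ + n),
      |U n t - U n s| ≤ |t - s| := by
    intro n s hs t ht
    have := (convex_Icc _ _).norm_image_sub_le_of_norm_hasDerivWithin_le (C := 1) (hUd n)
      (fun r _ => by
        rw [norm_neg]
        exact abs_le.2 ⟨le_max_left _ _, max_le (by norm_num) (min_le_left _ _)⟩) hs ht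
    rwa [one_mul] at this
  have hYtaylor : ∀ n : ℕ, ∀ s ∈ Icc (t₀ - n) (t₀ + n), ∀ t ∈ Icc (t₀ - n) (t₀ + n),
      |Y n t - Y n s - U n s * (t - s)| ≤ |t - s| * |t - s| := by
    intro n s hs t ht
    have hsub : uIcc s t ⊆ Icc (t₀ - n) (t₀ + n) := ordConnected_Icc.uIcc_subset hs ht
    have := (convex_uIcc s t).norm_image_sub_le_of_norm_hasDerivWithin_le (C := |t - s|)
      (f := fun r => Y n r - U n s * r) (f' := fun r => U n r - U n s * 1)
      (fun r hr => ((hYd n r (hsub hr)).mono hsub).sub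
        ((hasDerivWithinAt_id r _).const_mul (U n s)))
      (fun r hr => by
        rw [mul_one]
        exact (hUlip n s hs r (hsub hr)).trans (abs_sub_left_of_mem_uIcc hr))
      left_mem_uIcc right_mem_uIcc
    refine le_trans (le_of_eq ?_) this
    rw [Real.norm_eq_abs]
    congr 1; ring
  let 𝒰 : Filter ℕ := hyperfilter ℕ
  have h𝒰 : 𝒰 ≤ atTop := Nat.hyperfilter_le_atTop
  have hev : ∀ t, ∀ᶠ n : ℕ in 𝒰, t ∈ Icc (t₀ - n) (t₀ + n) := by
    intro t
    filter_upwards [h𝒰 (tendsto_natCast_atTop_atTop.eventually_ge_atTop |t - t₀|)] with n hn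
    have := abs_le.1 hn
    exact ⟨by linarith [this.1], by linarith [this.2]⟩
  have ht₀ : ∀ n : ℕ, t₀ ∈ Icc (t₀ - n) (t₀ + n) := fun n => by simp
  have hUb : ∀ t, ∀ᶠ n in 𝒰, |U n t| ≤ |u₀| + |t - t₀| := by
    intro t
    filter_upwards [hev t] with n hn
    have h1 := hUlip n t₀ (ht₀ n) t hn
    have h2 := abs_sub_abs_le_abs_sub (U n t) (U n t₀)
    rw [hU0] at h1 h2
    linarith
  have hYb : ∀ t, ∀ᶠ n in 𝒰, |Y n t| ≤ |y₀| + |u₀| * |t - t₀| + |t - t₀| * |t - t₀| := by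
    intro t
    filter_upwards [hev t] with n hn
    have h1 := hYtaylor n t₀ (ht₀ n) t hn
    rw [hU0, hY0] at h1
    have h2 : Y n t = (Y n t - y₀ - u₀ * (t - t₀)) + (y₀ + u₀ * (t - t₀)) := by ring
    have h3 := abs_add_le (Y n t - y₀ - u₀ * (t - t₀)) (y₀ + u₀ * (t - t₀))
    have h4 := abs_add_le y₀ (u₀ * (t - t₀))
    rw [← h2] at h3
    rw [abs_mul] at h4
    linarith
  -- along an ultrafilter every bounded sequence converges, which replaces Arzelà–Ascoli
  have hlim : ∀ (a : ℕ → ℝ) (C : ℝ), (∀ᶠ n in 𝒰, |a n| ≤ C) → ∃ l, Tendsto a 𝒰 (𝓝 l) := by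
    intro a C h
    obtain ⟨l, -, hl⟩ := (isCompact_Icc (a := -C) (b := C)).ultrafilter_le_nhds'
      ((hyperfilter ℕ).map a) (by
        rw [Ultrafilter.mem_map]
        filter_upwards [h] with n hn using abs_le.1 hn)
    exact ⟨l, hl⟩
  choose u hu using fun t => hlim _ _ (hUb t)
  choose y hy using fun t => hlim _ _ (hYb t)
  have : 𝒰.NeBot := (hyperfilter ℕ).neBot
  have hulip : ∀ s t, |u t - u s| ≤ |t - s| := fun s t =>
    le_of_tendsto ((hu t).sub (hu s)).abs (by
      filter_upwards [hev s, hev t] with n hs ht using hUlip n s hs t ht)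
  have hytaylor : ∀ s t, |y t - y s - u s * (t - s)| ≤ |t - s| * |t - s| := fun s t =>
    le_of_tendsto (((hy t).sub (hy s)).sub ((hu s).mul_const (t - s))).abs (by
      filter_upwards [hev s, hev t] with n hs ht using hYtaylor n s hs t ht)
  refine ⟨y, u, ?_, ?_, fun s => ?_, ?_, fun σ hσ t ht => ?_⟩
  · exact tendsto_nhds_unique (hy t₀) (by simp only [hY0]; exact tendsto_const_nhds)
  · exact tendsto_nhds_unique (hu t₀) (by simp only [hU0]; exact tendsto_const_nhds)
  · rw [hasDerivAt_iff_isLittleO]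
    refine Asymptotics.IsBigO.trans_isLittleO (g := fun t => (t - s) ^ 2) ?_ ?_
    · refine Asymptotics.IsBigO.of_bound 1 (Eventually.of_forall fun t => ?_)
      have h1 := hytaylor s t
      rw [Real.norm_eq_abs, Real.norm_eq_abs, one_mul, sq, abs_mul, smul_eq_mul, mul_comm (t - s)]
      exact h1
    · simpa only [Real.norm_eq_abs, sq_abs] using
        Asymptotics.isLittleO_pow_sub_sub s one_lt_two
  · refine LipschitzWith.of_dist_le_mul fun s t => ?_
    rw [NNReal.coe_one, one_mul]
    exact hulip t s
  · -- near `t` the approximations eventually lie in `σ * (Y n + q) ≥ 1 / n`, where the clamped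
    -- nonlinearity equals `σ`
    set V : ℝ := |u₀| + |t - t₀| with hV
    have hV0 : 0 ≤ V := by positivity
    obtain ⟨η, hη, hηt⟩ : ∃ η, 0 < η ∧ σ * (y t + q t) = 4 * η :=
      ⟨σ * (y t + q t) / 4, by positivity, by ring⟩
    obtain ⟨δ, hδ, hqδ⟩ := Metric.continuousAt_iff.1 (hq.continuousAt (x := t)) η hη
    obtain ⟨ρ, hρ, hρ1, hρδ, hρη⟩ : ∃ ρ : ℝ, 0 < ρ ∧ ρ ≤ 1 ∧ ρ ≤ δ ∧ (V + 1) * ρ ≤ η := by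
      refine ⟨min 1 (min δ (η / (V + 1))), by positivity, min_le_left _ _,
        (min_le_right _ _).trans (min_le_left _ _), ?_⟩
      rw [mul_comm, ← le_div_iff₀ (by positivity)]
      exact (min_le_right _ _).trans (min_le_right _ _)
    have hnear : ∀ s ∈ Metric.ball t ρ, u s = u t - σ * (s - t) := by
      intro s hs
      rw [Metric.mem_ball, Real.dist_eq] at hs
      refine tendsto_nhds_unique (hu s) (((hu t).sub_const _).congr' ?_)
      have hYt : ∀ᶠ n in 𝒰, 3 * η < σ * (Y n t + q t) :=
        (((hy t).add_const (q t)).const_mul σ).eventually_const_lt (by linarith)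
      filter_upwards [hev s, hev t, hUb t, hYt,
        h𝒰 (tendsto_natCast_atTop_atTop.eventually_ge_atTop (1 / η))] with n hns hnt hUn hYn hnη
      rw [div_le_iff₀ hη] at hnη
      have hsub : uIcc t s ⊆ Icc (t₀ - n) (t₀ + n) := ordConnected_Icc.uIcc_subset hnt hns
      have hfar : ∀ r ∈ uIcc t s, η ≤ σ * (Y n r + q r) := by
        intro r hr
        have hrt : |r - t| < ρ := (abs_sub_left_of_mem_uIcc hr).trans_lt hs
        have h1 := hYtaylor n t hnt r (hsub hr)
        have h2 := hqδ (show dist r t < δ from hrt.trans_le hρδ)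
        rw [Real.dist_eq] at h2
        have h3 : |U n t * (r - t)| ≤ V * ρ := by
          rw [abs_mul]
          exact mul_le_mul hUn hrt.le (abs_nonneg _) hV0
        have h4 : |r - t| * |r - t| ≤ 1 * ρ :=
          mul_le_mul (hrt.le.trans hρ1) hrt.le (abs_nonneg _) zero_le_one
        have h5 := abs_le.1 h1
        have h6 := abs_le.1 h2.le
        have h7 := abs_le.1 h3
        rcases hσ with rfl | rfl <;> linarith
      have hder : ∀ r ∈ uIcc t s, HasDerivWithinAt (fun r => U n r + σ * r) 0 (uIcc t s) r := by
        intro r hr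
        convert! ((hUd n r (hsub hr)).mono hsub).add
          ((hasDerivWithinAt_id r _).const_mul σ) using 1
        have h1 := hfar r hr
        have hn0 : (0 : ℝ) ≤ n := n.cast_nonneg
        have h2 : 1 ≤ σ * (n * (Y n r + q r)) := by nlinarith
        rcases hσ with rfl | rfl
        · rw [min_eq_left (by linarith), max_eq_right (by norm_num)]; ring
        · rw [min_eq_right (by linarith), max_eq_left (by linarith)]; ring
      have hconst := (convex_uIcc t s).norm_image_sub_le_of_norm_hasDerivWithin_le
        (C := 0) hder (by simp) left_mem_uIcc right_mem_uIcc
      rw [zero_mul, norm_le_zero_iff] at hconst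
      linarith
    have hline : HasDerivAt (fun s => u t - σ * (s - t)) (-σ) t := by
      simpa using (((hasDerivAt_id t).sub_const t).const_mul σ).const_sub (u t)
    refine hline.congr_of_eventuallyEq ?_
    filter_upwards [Metric.ball_mem_nhds t hρ] with s hs using hnear s hs

/-- With `y = x - Q`, where `Q` is a second primitive of `p`, the equation becomes
`ÿ = -sign (y + Q(t))`, whose forcing is continuous. -/
theorem exists_isSolutionOn_univ {p : ℝ → ℝ} {T : ℝ} (hT : 0 < T)
    (hper : Function.Periodic p T) (hint : IntervalIntegrable p volume 0 T)
    (havg : ∫ s in (0 : ℝ)..T, p s = 0) (t₀ x₀ v₀ : ℝ) :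
    ∃ x : ℝ → ℝ, IsSolutionOn p univ x ∧ x t₀ = x₀ ∧ deriv x t₀ = v₀ := by
  obtain ⟨P, Q, hPac, hPd, hQd, -, -, -⟩ := exists_periodic_primitives hT hper hint havg
  have hQc : Continuous Q := continuous_iff_continuousAt.2 fun t => (hQd t).continuousAt
  obtain ⟨y, u, hy0, hu0, hyd, hul, hus⟩ :=
    exists_sign_trajectory hQc t₀ (x₀ - Q t₀) (v₀ - P t₀)
  have hxd : ∀ t, HasDerivAt (fun t => y t + Q t) (u t + P t) t := fun t => (hyd t).add (hQd t)
  have hderiv : deriv (fun t => y t + Q t) = fun t => u t + P t := funext fun t => (hxd t).deriv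
  refine ⟨fun t => y t + Q t, ⟨fun t _ => (hxd t).differentiableAt, fun a _ b _ => ?_, ?_⟩,
    by simp [hy0], by simp [hderiv, hu0]⟩
  · rw [hderiv]
    exact hul.lipschitzOnWith.absolutelyContinuousOnInterval.add (hPac a b)
  · rw [hderiv]
    filter_upwards [hPd, hul.ae_differentiableAt_real] with t hPt hut _
    refine ⟨-deriv u t, ?_, ?_⟩
    · rw [filippovSign]
      split_ifs with h0
      · have := norm_deriv_le_of_lipschitz (x₀ := t) hul
        rw [Real.norm_eq_abs, NNReal.coe_one, abs_le] at this
        exact ⟨by linarith [this.2], by linarith [this.1]⟩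
      · rw [mem_singleton_iff]
        rcases lt_or_gt_of_ne h0 with h | h
        · rw [Real.sign_of_neg h, (hus (-1) (Or.inr rfl) t (by linarith)).deriv]; norm_num
        · rw [Real.sign_of_pos h, (hus 1 (Or.inl rfl) t (by linarith)).deriv]; norm_num
    · convert! hut.hasDerivAt.add hPt using 1
      ring

/-! ### Existence and boundedness -/

theorem corollary1 (p : ℝ → ℝ) (T : ℝ) (hT : 0 < T)
    (hper : Function.Periodic p T)
    (hint : IntervalIntegrable p MeasureTheory.volume 0 T)
    (havg : (1 / T) * (∫ s in (0 : ℝ)..T, p s) = 0)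
    (t₀ x₀ v₀ : ℝ) :
    (∃ x : ℝ → ℝ, IsSolutionOn p Set.univ x ∧ x t₀ = x₀ ∧ deriv x t₀ = v₀) ∧
    (∀ x : ℝ → ℝ, IsSolutionOn p Set.univ x → x t₀ = x₀ → deriv x t₀ = v₀ →
      BddAbove (Set.range fun t : ℝ => |x t| + |deriv x t|)) ∧
    (∀ (I : Set ℝ) (x : ℝ → ℝ), IsOpen I → I.OrdConnected → t₀ ∈ I →
      IsSolutionOn p I x → x t₀ = x₀ → deriv x t₀ = v₀ →
      BddAbove ((fun t : ℝ => |x t| + |deriv x t|) '' I)) := by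
  have havg' : ∫ s in (0 : ℝ)..T, p s = 0 :=
    (mul_eq_zero.1 havg).resolve_left (one_div_ne_zero hT.ne')
  refine ⟨exists_isSolutionOn_univ hT hper hint havg' t₀ x₀ v₀, fun x hx _ _ => ?_,
    fun I x hIo hI ht₀ hx _ _ => hx.bddAbove hT hper hint havg' hIo hI ht₀⟩
  rw [← image_univ]
  exact hx.bddAbove hT hper hint havg' isOpen_univ ordConnected_univ (mem_univ t₀)
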